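/- Let $n\ge 1$ and let $S_n$ be the set of permutations $\pi=(\pi_1\,\pi_2\,\ldots\,\pi_n)$ of $\{1,\ldots,n\}$. A pinnacle of $\pi$ is an element $\pi_i$ with $1<i<n$ and $\pi_{i-1}<\pi_i>\pi_{i+1}$. A reversal replaces a block $\pi_a\,\pi_{a+1}\ldots\pi_b$ of $\pi$, where $1\le a\le b\le n$, by $\pi_b\,\pi_{b-1}\ldots\pi_a$; it is balanced for $\pi$ if the resulting permutation has the same pinnacle set as $\pi$. For a set $S\subseteq\{1,\ldots,n\}$ with $|S|=d$ and $2d<n$, the canonical permutation $\mathrm{Id}_S\in S_n$ has the elements of $S$ in increasing order on positions $2,4,\ldots,2d$, and the elements of $\{1,\ldots,n\}\setminus S$ in increasing order on positions $1,3,\ldots,2d-1,2d+1,2d+2,\ldots,n$. Let $\pi\in S_n$ be a permutation with pinnacle set $S$, and let $p=|S|$ (then $2p<n$). Then $\pi$ can be transformed into $\mathrm{Id}_S$ by a finite sequence of reversals, each of which is balanced for the permutation it is applied to. The sequence can be chosen to consist of at most $2n-\min\{p,3\}$ reversals if $p\ge 1$, and of at most $2n-1$ reversals if $p=0$. -/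

import Mathlib

/-!
Permutations `π ∈ S_n` are elements of `Equiv.Perm (Fin n)`; `π i` is the entry in position `i`.
Positions and values both run over `0, …, n-1` instead of `1, …, n`.
-/

/-- The pinnacle set of `π`: the elements `π j` in an interior position `j` that are larger than both
of their neighbours. -/
def pinnacleSet {n : ℕ} (π : Equiv.Perm (Fin n)) : Finset (Fin n) :=
  Finset.univ.filter fun x => ∃ i j k : Fin n,
    (i : ℕ) + 1 = j ∧ (j : ℕ) + 1 = k ∧ π j = x ∧ π i < π j ∧ π k < π j

/-- The map on positions that reverses the block `a, a+1, …, b` and fixes all other positions. -/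
def blockFlip {n : ℕ} (a b : Fin n) (i : Fin n) : Fin n :=
  if h : a ≤ i ∧ i ≤ b then
    ⟨(a : ℕ) + b - i, by
      have h1 : (a : ℕ) ≤ i := h.1
      have h2 : (i : ℕ) ≤ b := h.2
      omega⟩
  else i

theorem blockFlip_involutive {n : ℕ} (a b : Fin n) : Function.Involutive (blockFlip a b) := by
  intro i
  by_cases h : a ≤ i ∧ i ≤ b
  · have h1 : (a : ℕ) ≤ i := h.1
    have h2 : (i : ℕ) ≤ b := h.2
    have e : blockFlip a b i = ⟨(a : ℕ) + b - i, by omega⟩ := dif_pos h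
    have h' : a ≤ blockFlip a b i ∧ blockFlip a b i ≤ b := by
      rw [e]; constructor <;> (rw [Fin.le_def]; simp only []; omega)
    have e' : ((blockFlip a b (blockFlip a b i) : Fin n) : ℕ) =
        (a : ℕ) + b - (blockFlip a b i : Fin n) := by
      conv_lhs => rw [blockFlip, dif_pos h']
    apply Fin.ext
    rw [e', e]
    simp only []
    omega
  · have e : blockFlip a b i = i := dif_neg h
    rw [e, e]

/-- The permutation obtained from `π` by reversing the block with endpoints `π a` and `π b`
(used only for `a ≤ b`). -/
def applyReversal {n : ℕ} (π : Equiv.Perm (Fin n)) (a b : Fin n) : Equiv.Perm (Fin n) :=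
  (blockFlip_involutive a b).toPerm.trans π

/-- The reversal of the block of `π` in positions `a, …, b` is balanced for `π`:
it does not change the pinnacle set. -/
def IsBalancedReversal {n : ℕ} (π : Equiv.Perm (Fin n)) (a b : Fin n) : Prop :=
  a ≤ b ∧ pinnacleSet (applyReversal π a b) = pinnacleSet π

/-- The sequence `R` of reversals (each given by the positions of the endpoints of its block)
transforms `π` into `σ`, and each reversal is balanced for the permutation it is applied to. -/
def BalancedTransforms {n : ℕ} :
    List (Fin n × Fin n) → Equiv.Perm (Fin n) → Equiv.Perm (Fin n) → Prop
  | [], π, σ => π = σ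
  | (a, b) :: R, π, σ =>
      IsBalancedReversal π a b ∧ BalancedTransforms R (applyReversal π a b) σ

/-- The entry of the canonical permutation in (zero-based) position `i`: with `d = |S|`, positions
`1, 3, …, 2d-1` carry `S` in increasing order, and positions `0, 2, …, 2d-2, 2d, 2d+1, …, n-1`
carry the complement of `S` in increasing order. -/
def canonicalFun {n : ℕ} (S : Finset (Fin n)) (hS : 2 * S.card < n) (i : Fin n) : Fin n :=
  if h : (i : ℕ) < 2 * S.card then
    if (i : ℕ) % 2 = 1 then
      S.orderEmbOfFin rfl ⟨(i : ℕ) / 2, by omega⟩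
    else
      Sᶜ.orderEmbOfFin rfl ⟨(i : ℕ) / 2, by rw [Finset.card_compl, Fintype.card_fin]; omega⟩
  else
    Sᶜ.orderEmbOfFin rfl
      ⟨(i : ℕ) - S.card, by rw [Finset.card_compl, Fintype.card_fin]; omega⟩

theorem canonicalFun_injective {n : ℕ} (S : Finset (Fin n)) (hS : 2 * S.card < n) :
    Function.Injective (canonicalFun S hS) := by
  have hne : ∀ (x : Fin S.card) (y : Fin Sᶜ.card),
      S.orderEmbOfFin rfl x ≠ Sᶜ.orderEmbOfFin rfl y := by
    intro x y h
    have h1 := Finset.orderEmbOfFin_mem S rfl x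
    have h2 := Finset.orderEmbOfFin_mem Sᶜ rfl y
    rw [h] at h1
    exact (Finset.mem_compl.1 h2) h1
  intro i j hij
  unfold canonicalFun at hij
  apply Fin.ext
  split_ifs at hij
  all_goals first
    | exact absurd hij (hne _ _)
    | exact absurd hij.symm (hne _ _)
    | (have h := congrArg Fin.val ((RelEmbedding.injective _) hij)
       simp only [] at h
       omega)

/-- The canonical permutation `Id_S`. -/
noncomputable def canonicalPerm {n : ℕ} (S : Finset (Fin n)) (hS : 2 * S.card < n) :
    Equiv.Perm (Fin n) :=
  Equiv.ofBijective (canonicalFun S hS) (Finite.injective_iff_bijective.1 (canonicalFun_injective S hS))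

/-- A pinnacle set is small enough for its canonical permutation to be defined. -/
theorem two_mul_card_pinnacleSet_lt {n : ℕ} (hn : 1 ≤ n) (π : Equiv.Perm (Fin n)) :
    2 * (pinnacleSet π).card < n := by
  have key : ∀ x ∈ pinnacleSet π, 0 < (π.symm x : ℕ) ∧ (π.symm x : ℕ) + 1 < n ∧
      ∀ y ∈ pinnacleSet π, (π.symm x : ℕ) + 1 ≠ π.symm y := by
    intro x hx
    obtain ⟨i, j, k, hij, hjk, rfl, h1, h2⟩ := (Finset.mem_filter.1 hx).2
    rw [Equiv.symm_apply_apply]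
    refine ⟨by omega, by omega, ?_⟩
    intro y hy
    obtain ⟨i', j', k', hij', hjk', rfl, h1', h2'⟩ := (Finset.mem_filter.1 hy).2
    rw [Equiv.symm_apply_apply]
    intro h
    have e1 : k = j' := Fin.ext (by omega)
    have e2 : i' = j := Fin.ext (by omega)
    subst e1 e2
    exact lt_asymm h2 h1'
  let A : Finset ℕ := (pinnacleSet π).image fun x => (π.symm x : ℕ)
  let B : Finset ℕ := (pinnacleSet π).image fun x => (π.symm x : ℕ) + 1
  have hA : A.card = (pinnacleSet π).card := Finset.card_image_of_injective _
    (fun x y h => π.symm.injective (Fin.ext h))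
  have hB : B.card = (pinnacleSet π).card := Finset.card_image_of_injective _
    (fun x y h => π.symm.injective (Fin.ext (Nat.succ_injective h)))
  have hAB : Disjoint A B := by
    rw [Finset.disjoint_left]
    intro z hz hz'
    obtain ⟨x, hx, rfl⟩ := Finset.mem_image.1 hz
    obtain ⟨y, hy, h⟩ := Finset.mem_image.1 hz'
    exact (key y hy).2.2 x hx h
  have hsub : A ∪ B ⊆ Finset.Ioo 0 n := by
    intro z hz
    rw [Finset.mem_Ioo]
    rcases Finset.mem_union.1 hz with h | h
    · obtain ⟨x, hx, rfl⟩ := Finset.mem_image.1 h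
      have := key x hx
      exact ⟨this.1, by omega⟩
    · obtain ⟨x, hx, rfl⟩ := Finset.mem_image.1 h
      have := key x hx
      exact ⟨by omega, this.2.1⟩
  have := Finset.card_le_card hsub
  rw [Finset.card_union_of_disjoint hAB, hA, hB, Nat.card_Ioo] at this
  omega

/-! Induct on the length of the word. Let `v` be the largest non-pinnacle. At most two balanced
reversals bring it to the right end (`exists_balancedReach_max_last`).

If its neighbour is then not a pinnacle, `v` can be deleted without changing the status of any other
entry, and the shorter word is sorted by induction. Those reversals lift to the longer word: each
arrangement they pass through ends in a non-pinnacle smaller than `v`, so putting `v` back does no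
harm (`BalancedReach.append`).

If the neighbour is a pinnacle `q`, at most one reversal has been used. When some non-pinnacles `x
y` are adjacent, reversing the block from `y` to `q` puts `y` beside `v`, and `v` is deleted.
Otherwise pinnacles and non-pinnacles alternate; one more reversal puts the largest pinnacle `s`
beside `v`, and the pair `s v` is deleted.

Deleting `v` costs at most 2 reversals and deleting `s v` at most 2, while the budget `2 * length -
p - 2` falls by 2 and by 3. This is stronger than the claimed bounds. -/

section ListReversals

/-! ### Words, their ends and interleaving. -/

variable {α : Type*}

/-- The first entry of `l`, or `w` if `l` is empty. -/
def headOr (l : List α) (w : WithTop α) : WithTop α :=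
  l.foldr (fun (x : α) _ => (x : WithTop α)) w

/-- The last entry of `l`, or `u` if `l` is empty. -/
def lastOr (l : List α) (u : WithTop α) : WithTop α :=
  l.foldl (fun _ (x : α) => (x : WithTop α)) u

@[simp] theorem headOr_nil (w : WithTop α) : headOr [] w = w := rfl
@[simp] theorem headOr_cons (x : α) (l : List α) (w : WithTop α) : headOr (x :: l) w = x := rfl
@[simp] theorem lastOr_nil (u : WithTop α) : lastOr [] u = u := rfl
@[simp] theorem lastOr_cons (x : α) (l : List α) (u : WithTop α) :
    lastOr (x :: l) u = lastOr l x := rfl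
@[simp] theorem headOr_append (l m : List α) (w : WithTop α) :
    headOr (l ++ m) w = headOr l (headOr m w) :=
  List.foldr_append
@[simp] theorem lastOr_append (l m : List α) (u : WithTop α) :
    lastOr (l ++ m) u = lastOr m (lastOr l u) :=
  List.foldl_append
@[simp] theorem headOr_reverse (l : List α) (w : WithTop α) :
    headOr l.reverse w = lastOr l w := List.foldr_reverse
@[simp] theorem lastOr_reverse (l : List α) (u : WithTop α) :
    lastOr l.reverse u = headOr l u := List.foldl_reverse

/-- The list `V₁ s₁ V₂ s₂ …`, continued by the rest of `V` when `s` is used up. -/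
def interleave : List α → List α → List α
  | V, [] => V
  | [], s => s
  | v :: V, x :: s => v :: x :: interleave V s

theorem interleave_nil (V : List α) : interleave V [] = V := by cases V <;> rfl

theorem interleave_perm (V s : List α) : (interleave V s).Perm (V ++ s) := by
  induction s generalizing V with
  | nil => simp [interleave_nil]
  | cons x s ih =>
    cases V with
    | nil => exact .refl _
    | cons v V =>
      refine .cons v ?_
      exact ((ih V).cons x).trans (List.perm_middle.symm)

theorem interleave_concat (V s : List α) (v : α) (h : s.length ≤ V.length) :
    interleave (V ++ [v]) s = interleave V s ++ [v] := by
  induction s generalizing V with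
  | nil => simp [interleave_nil]
  | cons x s ih =>
    cases V with
    | nil => simp at h
    | cons w V => simp [interleave, ih V (by simpa using h)]

/-- With exactly one more entry in `V` than in `s`, the interleaving has no tail, so the new pair
falls at the very end. -/
theorem interleave_concat_concat (V s : List α) (v x : α) (h : V.length = s.length + 1) :
    interleave (V ++ [v]) (s ++ [x]) = interleave V s ++ [x, v] := by
  induction s generalizing V with
  | nil =>
    obtain ⟨w, rfl⟩ := List.length_eq_one_iff.1 h
    rfl
  | cons y s ih =>
    cases V with
    | nil => simp at h
    | cons w V => simp [interleave, ih V (by simpa using h)]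

/-! ### Pinnacles of a word and the effect of changing a neighbour. -/

variable [LinearOrder α]

/-- In the list `l`, preceded by `u` and followed by `w`, the entries that are larger than both of
their neighbours are exactly those in `S`. The value `⊤` for `u` or `w` marks an end of the list. -/
def HasPinnacles (S : Finset α) : WithTop α → List α → WithTop α → Prop
  | _, [], _ => True
  | u, x :: l, w => (x ∈ S ↔ u < x ∧ headOr l w < x) ∧ HasPinnacles S x l w

variable {S : Finset α} {u w u' w' : WithTop α}

@[simp] theorem hasPinnacles_nil : HasPinnacles S u [] w := trivial

@[simp] theorem hasPinnacles_cons (x : α) (l : List α) : HasPinnacles S u (x :: l) w ↔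
    (x ∈ S ↔ u < x ∧ headOr l w < x) ∧ HasPinnacles S x l w := Iff.rfl

theorem hasPinnacles_append (l m : List α) : HasPinnacles S u (l ++ m) w ↔
    HasPinnacles S u l (headOr m w) ∧ HasPinnacles S (lastOr l u) m w := by
  induction l generalizing u with
  | nil => simp
  | cons x l ih => simp [ih, and_assoc]

theorem hasPinnacles_reverse (l : List α) :
    HasPinnacles S u l.reverse w ↔ HasPinnacles S w l u := by
  induction l generalizing w with
  | nil => simp
  | cons x l ih =>
    rw [List.reverse_cons, hasPinnacles_append]
    simp only [headOr_cons, headOr_nil, hasPinnacles_cons, hasPinnacles_nil, lastOr_reverse, ih]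
    tauto

/-- An entry `x` next to which the entry `y` may be placed, whatever its new other neighbour. -/
def Fits (S : Finset α) (x : α) (y : WithTop α) : Prop :=
  (x ∈ S ∧ y < x) ∨ (x ∉ S ∧ ¬ y < x)

theorem HasPinnacles.change_left {x : α} {l : List α} (h : HasPinnacles S u (x :: l) w)
    (hx : Fits S x u') : HasPinnacles S u' (x :: l) w := by
  rw [hasPinnacles_cons] at h ⊢
  unfold Fits at hx
  tauto

theorem HasPinnacles.change_right {x : α} {l : List α} (h : HasPinnacles S u (l ++ [x]) w)
    (hx : Fits S x w') : HasPinnacles S u (l ++ [x]) w' := by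
  rw [← hasPinnacles_reverse] at h ⊢
  rw [List.reverse_append] at h ⊢
  exact h.change_left hx

theorem fits_of_mem {x y : α} (h : x ∈ S) (hy : y < x) : Fits S x y :=
  Or.inl ⟨h, WithTop.coe_lt_coe.2 hy⟩

theorem fits_of_notMem {x y : α} (h : x ∉ S) (hy : x ≤ y) : Fits S x y :=
  Or.inr ⟨h, fun h' => absurd (WithTop.coe_lt_coe.1 h') hy.not_gt⟩

theorem fits_top {x : α} (h : x ∉ S) : Fits S x ⊤ :=
  Or.inr ⟨h, not_top_lt⟩

theorem HasPinnacles.head_notMem {x : α} {l : List α} (h : HasPinnacles S ⊤ (x :: l) w) :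
    x ∉ S := fun hx => not_top_lt (h.1.1 hx).1

theorem HasPinnacles.last_notMem {x : α} {l : List α} (h : HasPinnacles S u (l ++ [x]) ⊤) :
    x ∉ S := by
  rw [← hasPinnacles_reverse, List.reverse_append] at h
  exact h.head_notMem

/-- An end entry is never a pinnacle, so deleting `v` is harmless exactly because its neighbour `x`
was not one. -/
theorem HasPinnacles.drop_last {x v : α} {l : List α}
    (h : HasPinnacles S ⊤ (l ++ [x, v]) ⊤) (hx : x ∉ S) : HasPinnacles S ⊤ (l ++ [x]) ⊤ := by
  have e : l ++ [x, v] = (l ++ [x]) ++ [v] := by simp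
  rw [e, hasPinnacles_append] at h
  exact h.1.change_right (fits_top hx)

/-- A list with the pinnacle set `S` can be extended by a non-pinnacle larger than all other
non-pinnacles. -/
theorem HasPinnacles.concat {v : α} {l : List α} (h : HasPinnacles S ⊤ l ⊤) (hv : v ∉ S)
    (hlt : ∀ x ∈ l, x ∉ S → x < v) : HasPinnacles S ⊤ (l ++ [v]) ⊤ := by
  rw [hasPinnacles_append]
  refine ⟨?_, by simp [hv]⟩
  rcases List.eq_nil_or_concat l with rfl | ⟨l, x, rfl⟩
  · simp
  · rw [List.concat_eq_append] at *
    exact h.change_right (fits_of_notMem h.last_notMem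
      (hlt x (by simp) h.last_notMem).le)

theorem HasPinnacles.concat_pinnacle {s v : α} {l : List α} (h : HasPinnacles S ⊤ l ⊤)
    (hl : l ≠ []) (hv : v ∉ S) (hs : s ∈ S) (hvs : v < s)
    (hlt : ∀ x ∈ l, x ∉ S → x < v) : HasPinnacles S ⊤ (l ++ [s, v]) ⊤ := by
  rw [hasPinnacles_append]
  rcases List.eq_nil_or_concat l with rfl | ⟨l, x, rfl⟩
  · exact absurd rfl hl
  · rw [List.concat_eq_append] at *
    have hx : x < s := (hlt x (by simp) h.last_notMem).trans hvs
    refine ⟨h.change_right (fits_of_notMem h.last_notMem hx.le), ?_⟩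
    simp [hv, hs, hx, hvs]

/-! ### Balanced reversals of words. -/

/-- `BalancedReach S k l m`: the list `m` arises from `l` by `k` reversals of blocks such that
all lists after `l` have the pinnacle set `S`. -/
inductive BalancedReach (S : Finset α) : ℕ → List α → List α → Prop
  | refl (l : List α) : BalancedReach S 0 l l
  | step {k : ℕ} (a b c m : List α) (hb : b ≠ [])
      (h : HasPinnacles S ⊤ (a ++ b.reverse ++ c) ⊤)
      (hr : BalancedReach S k (a ++ b.reverse ++ c) m) : BalancedReach S (k + 1) (a ++ b ++ c) m

theorem BalancedReach.trans {j k : ℕ} {l m r : List α} (h : BalancedReach S j l m)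
    (h' : BalancedReach S k m r) : BalancedReach S (j + k) l r := by
  induction h with
  | refl l => simpa using h'
  | step a b c m hb h hr ih =>
    rw [add_right_comm]
    exact .step a b c r hb h (ih h')

theorem BalancedReach.perm {k : ℕ} {l m : List α} (h : BalancedReach S k l m) : l.Perm m := by
  induction h with
  | refl l => exact .refl _
  | step a b c m hb h hr ih =>
    exact (((List.reverse_perm b).symm.append_left a).append_right c).trans ih

theorem BalancedReach.hasPinnacles {k : ℕ} {l m : List α} (h : BalancedReach S k l m)
    (hl : HasPinnacles S ⊤ l ⊤) : HasPinnacles S ⊤ m ⊤ := by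
  induction h with
  | refl l => exact hl
  | step a b c m hb h hr ih => exact ih h

/-- Lifts the sorting of a shortened word to the original one. The hypothesis ranges over all
arrangements of `l` because the intermediate words are not known. -/
theorem BalancedReach.append {k : ℕ} {l m t : List α} (h : BalancedReach S k l m)
    (ht : ∀ r : List α, r.Perm l → HasPinnacles S ⊤ r ⊤ → HasPinnacles S ⊤ (r ++ t) ⊤) :
    BalancedReach S k (l ++ t) (m ++ t) := by
  induction h with
  | refl l => exact .refl _
  | step a b c m hb h hr ih =>
    have hp := ((List.reverse_perm b).append_left a).append_right c
    have e : a ++ b ++ c ++ t = a ++ b ++ (c ++ t) := by simp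
    have e' : a ++ b.reverse ++ c ++ t = a ++ b.reverse ++ (c ++ t) := by simp
    rw [e]
    refine .step a b (c ++ t) _ hb ?_ ?_
    · rw [← e']
      exact ht _ hp h
    · rw [← e']
      exact ih fun r hr => ht r (hr.trans hp)

theorem BalancedReach.single {l m : List α} (a b c : List α) (hb : b ≠ []) (hl : l = a ++ b ++ c)
    (hm : m = a ++ b.reverse ++ c) (h : HasPinnacles S ⊤ m ⊤) : BalancedReach S 1 l m := by
  subst hl hm
  exact .step a b c _ hb h (.refl _)

theorem balancedReach_reverse {l : List α} (hl : l ≠ []) (h : HasPinnacles S ⊤ l ⊤) :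
    BalancedReach S 1 l l.reverse :=
  .single [] l [] hl (by simp) (by simp) ((hasPinnacles_reverse l).2 h)

/-- The suffix behind a pinnacle that exceeds the last entry can be reversed. -/
theorem balancedReach_suffix {a b : List α} {q v : α}
    (h : HasPinnacles S ⊤ (a ++ q :: v :: b) ⊤) (hq : q ∈ S) (hv : v ∉ S)
    (hlt : ∀ x ∈ b, x ∉ S → x < q) (hb : b ≠ []) :
    BalancedReach S 1 (a ++ q :: v :: b) (a ++ q :: (b.reverse ++ [v])) := by
  refine .single (a ++ [q]) (v :: b) [] (by simp) (by simp) (by simp) ?_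
  obtain ⟨b, z, rfl⟩ := (List.eq_nil_or_concat b).resolve_left hb
  rw [List.concat_eq_append] at *
  have e : a ++ q :: v :: (b ++ [z]) = (a ++ [q]) ++ (v :: b ++ [z]) := by simp
  rw [e] at h
  rw [hasPinnacles_append] at h
  have hz : z ∉ S := HasPinnacles.last_notMem h.2
  have hzq : z < q := hlt z (by simp) hz
  have e' : a ++ q :: ((b ++ [z]).reverse ++ [v]) = (a ++ [q]) ++ (v :: b ++ [z]).reverse := by simp
  rw [e', hasPinnacles_append, hasPinnacles_reverse]
  refine ⟨?_, ?_⟩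
  -- `q` gets the smaller neighbour `z`, so it stays a pinnacle.
  · simpa using h.1.change_right (fits_of_mem hq hzq)
  · have h2 := h.2.change_right (w' := (q : WithTop α)) (fits_of_notMem hz hzq.le)
    simpa using HasPinnacles.change_left (l := b ++ [z]) h2 (fits_top hv)

/-- The block between a non-pinnacle `x` and the last entry can be reversed if it ends in a pinnacle
larger than `x` and starts with an entry that fits beside the last one. -/
theorem balancedReach_block {a b : List α} {x y q v : α}
    (h : HasPinnacles S ⊤ (a ++ x :: y :: (b ++ [q, v])) ⊤) (hx : x ∉ S) (hq : q ∈ S)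
    (hxq : x < q) (hy : Fits S y v) :
    BalancedReach S 1 (a ++ x :: y :: (b ++ [q, v])) (a ++ x :: q :: (b.reverse ++ [y, v])) := by
  refine .single (a ++ [x]) (y :: b ++ [q]) [v] (by simp) (by simp) (by simp) ?_
  have e : a ++ x :: y :: (b ++ [q, v]) = (a ++ [x]) ++ ((y :: b ++ [q]) ++ [v]) := by simp
  rw [e, hasPinnacles_append (a ++ [x]), hasPinnacles_append (y :: b ++ [q])] at h
  have hv : v ∉ S := by
    have := h.2.2
    exact HasPinnacles.last_notMem (l := []) this
  have e' : a ++ x :: q :: (b.reverse ++ [y, v]) =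
    (a ++ [x]) ++ ((y :: b ++ [q]).reverse ++ [v]) := by simp
  rw [e', hasPinnacles_append (a ++ [x]), hasPinnacles_append (y :: b ++ [q]).reverse,
    hasPinnacles_reverse]
  refine ⟨?_, ?_, ?_⟩
  · simpa using h.1.change_right (fits_of_notMem hx hxq.le)
  · have h2 := h.2.1.change_right (w' := (x : WithTop α)) (fits_of_mem hq hxq)
    simpa using HasPinnacles.change_left (l := b ++ [q]) h2 hy
  · simp [hv]

/-- Without two adjacent entries outside `S`, at most one more entry lies outside `S` than inside.
The clause about the head only strengthens the induction. -/
theorem exists_adjacent_notMem_or_length_le (S : Finset α) (l : List α) :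
    (∃ a b x y, l = a ++ x :: y :: b ∧ x ∉ S ∧ y ∉ S) ∨
      (l.length ≤ 2 * l.countP (· ∈ S) + 1 ∧
        ∀ x ∈ l.head?, x ∈ S → l.length ≤ 2 * l.countP (· ∈ S)) := by
  induction l with
  | nil => right; simp
  | cons x l ih =>
    rcases ih with ⟨a, b, y, z, rfl, h⟩ | ⟨h1, h2⟩
    · exact Or.inl ⟨x :: a, b, y, z, rfl, h⟩
    · by_cases hx : x ∈ S
      · right
        simp [hx]
        omega
      · cases l with
        | nil => right; simp [hx]
        | cons y l =>
          by_cases hy : y ∈ S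
          · right
            have := h2 y (by simp) hy
            simp [hx, hy] at this ⊢
            omega
          · exact Or.inl ⟨[], l, x, y, rfl, hx, hy⟩

/-! ### Sorting by induction on the length. -/

/-- `l` is transformed by at most `2 |l| - p - 2` balanced reversals into its canonical
arrangement, where `p` is the number of its pinnacles. -/
def CanBeSorted (S : Finset α) (l : List α) : Prop :=
  ∃ V s k, V.Pairwise (· < ·) ∧ s.Pairwise (· < ·) ∧ (∀ x ∈ V, x ∉ S) ∧ (∀ x ∈ s, x ∈ S) ∧
    s.length < V.length ∧ BalancedReach S k l (interleave V s) ∧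
    k + s.length + 2 ≤ 2 * l.length

theorem CanBeSorted.concat {l : List α} {v : α} (h : CanBeSorted S l) (hv : v ∉ S)
    (hlt : ∀ x ∈ l, x ∉ S → x < v) {m : List α} {k : ℕ} (hr : BalancedReach S k m (l ++ [v]))
    (hk : k ≤ 2) : CanBeSorted S m := by
  obtain ⟨V, s, j, hV, hs, hVS, hsS, hlen, hj, hjk⟩ := h
  have hp : l.Perm (V ++ s) := hj.perm.trans (interleave_perm V s)
  have hmem : ∀ x ∈ V, x < v := fun x hx => hlt x (hp.mem_iff.2 (by simp [hx])) (hVS x hx)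
  refine ⟨V ++ [v], s, k + j, ?_, hs, ?_, hsS, ?_, ?_, ?_⟩
  · simpa [List.pairwise_append, hV] using hmem
  · intro x hx
    rcases List.mem_append.1 hx with hx | hx
    · exact hVS x hx
    · rwa [List.mem_singleton.1 hx]
  · simp; omega
  · rw [interleave_concat V s v hlen.le]
    refine hr.trans (hj.append fun r hrl hrS => hrS.concat hv fun x hx => hlt x (hrl.mem_iff.1 hx))
  · have := hr.perm.length_eq
    simp at this
    omega

/-- The count `hcount` forces the canonical arrangement of `l` to alternate up to its end, so that
`x, v` continues it. Two entries and one pinnacle more leave room for 3 reversals. -/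
theorem CanBeSorted.concat_pinnacle {l : List α} {v x : α} (h : CanBeSorted S l)
    (hl : l ≠ []) (hv : v ∉ S) (hx : x ∈ S) (hvx : v < x)
    (hltv : ∀ y ∈ l, y ∉ S → y < v) (hltx : ∀ y ∈ l, y ∈ S → y < x)
    (hcount : (l ++ [x, v]).length ≤ 2 * (l ++ [x, v]).countP (· ∈ S) + 1)
    {m : List α} {k : ℕ} (hr : BalancedReach S k m (l ++ [x, v]))
    (hk : k ≤ 3) : CanBeSorted S m := by
  obtain ⟨V, s, j, hV, hs, hVS, hsS, hlen, hj, hjk⟩ := h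
  have hp : l.Perm (V ++ s) := hj.perm.trans (interleave_perm V s)
  have hcV : V.countP (· ∈ S) = 0 := List.countP_eq_zero.2 (by simpa using hVS)
  have hcs : s.countP (· ∈ S) = s.length := List.countP_eq_length.2 (by simpa using hsS)
  have hlen' : V.length = s.length + 1 := by
    have h1 := hp.countP_eq (· ∈ S)
    have h2 := hp.length_eq
    rw [List.countP_append, hcV, hcs] at h1
    rw [List.length_append] at h2
    simp [List.countP_append, h1, h2, hx, hv] at hcount
    omega
  have hmemV : ∀ y ∈ V, y < v := fun y hy => hltv y (hp.mem_iff.2 (by simp [hy])) (hVS y hy)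
  have hmems : ∀ y ∈ s, y < x := fun y hy => hltx y (hp.mem_iff.2 (by simp [hy])) (hsS y hy)
  refine ⟨V ++ [v], s ++ [x], k + j, ?_, ?_, ?_, ?_, ?_, ?_, ?_⟩
  · simpa [List.pairwise_append, hV] using hmemV
  · simpa [List.pairwise_append, hs] using hmems
  · intro y hy
    rcases List.mem_append.1 hy with hy | hy
    · exact hVS y hy
    · rwa [List.mem_singleton.1 hy]
  · intro y hy
    rcases List.mem_append.1 hy with hy | hy
    · exact hsS y hy
    · rwa [List.mem_singleton.1 hy]
  · simp; omega
  · rw [interleave_concat_concat V s v x hlen']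
    refine hr.trans (hj.append fun r hrl hrS => hrS.concat_pinnacle ?_ hv hx hvx
      fun y hy => hltv y (hrl.mem_iff.1 hy))
    rintro rfl
    exact hl (List.nil_perm.1 hrl)
  · have := hr.perm.length_eq
    simp at this ⊢
    omega

theorem List.exists_max_of_mem {l : List α} {p : α → Prop} {x : α} (hx : x ∈ l) (hp : p x) :
    ∃ v ∈ l, p v ∧ ∀ y ∈ l, p y → y ≤ v := by
  classical
  obtain ⟨v, hv, hmax⟩ := (l.toFinset.filter p).exists_max_image id ⟨x, by simp [hx, hp]⟩
  simp only [Finset.mem_filter, List.mem_toFinset, id] at hv hmax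
  exact ⟨v, hv.1, hv.2, fun y hy hpy => hmax y ⟨hy, hpy⟩⟩

/-- The largest non-pinnacle can be brought to the right end. -/
theorem exists_balancedReach_max_last {l : List α} (h : HasPinnacles S ⊤ l ⊤) (hnd : l.Nodup)
    (hl : 2 ≤ l.length) {v : α} (hvl : v ∈ l) (hv : v ∉ S) (hmax : ∀ x ∈ l, x ∉ S → x ≤ v) :
    ∃ k m y, BalancedReach S k l (m ++ [y, v]) ∧ (k ≤ 1 ∨ (k ≤ 2 ∧ y ∉ S)) := by
  have hlt : ∀ x ∈ l, x ∉ S → x ≠ v → x < v := fun x hx hxS hne => (hmax x hx hxS).lt_of_ne hne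
  obtain ⟨a, b, rfl⟩ := List.append_of_mem hvl
  have hne : ∀ x, x ∈ a ∨ x ∈ b → x ≠ v := by
    rintro x hx rfl
    have := (List.nodup_middle.1 hnd)
    simp only [List.nodup_cons, List.mem_append] at this
    exact this.1 hx
  rcases List.eq_nil_or_concat a with rfl | ⟨a, q, rfl⟩
  · have hr := balancedReach_reverse (by simp) h
    cases b with
    | nil => simp at hl
    | cons y b => exact ⟨1, b.reverse, y, by simpa using hr, Or.inl le_rfl⟩
  rw [List.concat_eq_append] at *
  have e : a ++ [q] ++ v :: b = a ++ q :: v :: b := by simp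
  rw [e] at h hnd hl hvl hmax hlt ⊢
  cases b with
  | nil => exact ⟨0, a, q, .refl _, Or.inl zero_le_one⟩
  | cons x b =>
    by_cases hq : q ∈ S
    · have hvq : v < q := by
        rw [hasPinnacles_append] at h
        simpa using (h.2.1.1 hq).2
      have hr := balancedReach_suffix h hq hv
        (fun y hy hyS => (hmax y (by simp [hy]) hyS).trans_lt hvq) (by simp)
      refine ⟨1, a ++ q :: b.reverse, x, ?_, Or.inl le_rfl⟩
      simpa using hr
    · have hqv : q < v := hlt q (by simp) hq (hne q (by simp))
      -- Otherwise `v` would exceed both neighbours and be a pinnacle. By maximality of `v`, the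
      -- larger `x` is then a pinnacle.
      have hvx : v < x := by
        by_contra hx
        have h' := h
        rw [hasPinnacles_append] at h'
        have hxv : x < v := lt_of_le_of_ne (not_lt.1 hx) (hne x (by simp))
        apply hv
        exact h'.2.2.1.2 ⟨WithTop.coe_lt_coe.2 hqv, WithTop.coe_lt_coe.2 hxv⟩
      have hx : x ∈ S := by
        by_contra hx
        exact (hmax x (by simp) hx).not_gt hvx
      -- Reversing the whole word puts the pinnacle `x` before `v`, which reduces to the previous
      -- case; `q` ends up beside `v`.
      have hr := balancedReach_reverse (by simp) h
      have e2 : (a ++ q :: v :: x :: b).reverse = b.reverse ++ x :: v :: (q :: a.reverse) := by simp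
      rw [e2] at hr
      have hr2 := balancedReach_suffix (hr.hasPinnacles h) hx hv
        (fun y hy hyS => (hmax y (by simp at hy ⊢; tauto) hyS).trans_lt hvx) (by simp)
      refine ⟨2, b.reverse ++ x :: a, q, ?_, Or.inr ⟨le_rfl, hq⟩⟩
      simpa using hr.trans hr2

theorem canBeSorted (l : List α) (hl : l ≠ []) (hnd : l.Nodup) (h : HasPinnacles S ⊤ l ⊤) :
    CanBeSorted S l := by
  induction hN : l.length using Nat.strong_induction_on generalizing l with
  | _ N ih =>
  subst hN
  obtain ⟨z, l', rfl⟩ := List.exists_cons_of_ne_nil hl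
  have hz := h.head_notMem
  obtain ⟨v, hvl, hv, hmax⟩ :=
    List.exists_max_of_mem (p := fun x => x ∉ S) (List.mem_cons_self (a := z) (l := l')) hz
  generalize z :: l' = l at *
  clear hz
  by_cases hlen : l.length ≤ 1
  · obtain ⟨w, rfl⟩ : ∃ w, l = [w] :=
      List.length_eq_one_iff.1 (le_antisymm hlen (List.length_pos_iff.2 hl))
    exact ⟨[w], [], 0, by simp, by simp, by simpa using h.head_notMem, by simp, by simp, .refl _,
      by simp⟩
  obtain ⟨k, m, q, hr, hk⟩ := exists_balancedReach_max_last h hnd (by omega) hvl hv hmax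
  have drop : ∀ {j : ℕ} {m : List α} {y : α}, BalancedReach S j l (m ++ [y, v]) → j ≤ 2 →
      y ∉ S → CanBeSorted S l := by
    intro j m y hr hj hy
    have e : m ++ [y, v] = m ++ [y] ++ [v] := by simp
    have hnd' := hr.perm.nodup_iff.1 hnd
    have hlen' := hr.perm.length_eq
    have hS := (hr.hasPinnacles h).drop_last hy
    have hmem : ∀ x, x ∈ m ++ [y] → x ∈ l := fun x hx => hr.perm.mem_iff.2 (by simp at hx ⊢; tauto)
    rw [e] at hr hnd' hlen'
    rw [List.nodup_append] at hnd'
    refine (ih _ (by simp at hlen' ⊢; omega) _ (by simp) hnd'.1 hS rfl).concat hv ?_ hr hj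
    intro x hx hxS
    exact lt_of_le_of_ne (hmax x (hmem x hx) hxS) (hnd'.2.2 x hx v (by simp))
  by_cases hq : q ∈ S
  swap
  · exact drop hr (by omega) hq
  have hk1 : k ≤ 1 := by tauto
  have hS := hr.hasPinnacles h
  have hmemS : ∀ x, x ∈ m ++ [q, v] → x ∈ l := fun x hx => hr.perm.mem_iff.2 hx
  have hvq : v < q := by
    rw [hasPinnacles_append] at hS
    simpa using (hS.2.1.1 hq).2
  rcases exists_adjacent_notMem_or_length_le S (m ++ [q, v]) with
    ⟨a, b, x, y, hab, hx, hy⟩ | ⟨hcount, -⟩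
  -- Neither `x` nor `y` is the pinnacle `q`, so the pair lies wholly to the left of `q`.
  · have hb : ∃ b', b = b' ++ [q, v] := by
      rcases List.eq_nil_or_concat b with rfl | ⟨b, v', rfl⟩
      · have e : a ++ [x, y] = (a ++ [x]) ++ [y] := by simp
        have e' : m ++ [q, v] = (m ++ [q]) ++ [v] := by simp
        rw [e, e'] at hab
        have := List.append_inj' hab rfl
        have := List.append_inj' this.1 rfl
        simp at this
        exact absurd (this.2 ▸ hq) hx
      rcases List.eq_nil_or_concat b with rfl | ⟨b, q', rfl⟩
      · have e : a ++ x :: y :: [].concat v' = (a ++ [x]) ++ [y, v'] := by simp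
        rw [e] at hab
        have := List.append_inj' hab rfl
        simp at this
        exact absurd (this.2.1 ▸ hq) hy
      · have e : a ++ x :: y :: (b.concat q').concat v' = (a ++ x :: y :: b) ++ [q', v'] := by simp
        rw [e] at hab
        have := List.append_inj' hab rfl
        simp at this
        exact ⟨b, by simp [this]⟩
    obtain ⟨b, rfl⟩ := hb
    rw [hab] at hS hr hmemS
    have hxv : x ≤ v := hmax x (hmemS x (by simp)) hx
    have hyv : y ≤ v := hmax y (hmemS y (by simp)) hy
    have hr2 := balancedReach_block hS hx hq (hxv.trans_lt hvq) (fits_of_notMem hy hyv)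
    have e : a ++ x :: q :: (b.reverse ++ [y, v]) = (a ++ x :: q :: b.reverse) ++ [y, v] := by simp
    rw [e] at hr2
    exact drop (hr.trans hr2) (by omega) hy
  · obtain ⟨s, hsl, hs, hsmax⟩ := List.exists_max_of_mem (l := l) (p := fun x => x ∈ S)
      (hmemS q (by simp)) hq
    have hvs : v < s := hvq.trans_le (hsmax q (hmemS q (by simp)) hq)
    -- Neighbours cannot both be pinnacles, so the entry before `s` is never one. If `s` is not yet
    -- beside `v`, reversing the block from `s` to `q` puts it there.
    have key : ∃ m' y j, BalancedReach S j l (m' ++ [y, s, v]) ∧ j ≤ 2 ∧ y ∉ S := by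
      have hsm := hr.perm.mem_iff.1 hsl
      have hsv : s ≠ v := hvs.ne'
      by_cases hsq : s = q
      · subst hsq
        rcases List.eq_nil_or_concat m with rfl | ⟨m, y, rfl⟩
        · exact absurd hs (HasPinnacles.head_notMem hS)
        · refine ⟨m, y, k, by simpa using hr, by omega, ?_⟩
          intro hy
          have e : m.concat y ++ [s, v] = m ++ [y, s, v] := by simp
          rw [e, hasPinnacles_append] at hS
          have h1 := (hS.2.1.1 hy).2
          have h2 := (hS.2.2.1.1 hs).1
          exact lt_asymm h1 h2
      · have hsm' : s ∈ m := by simpa [hsq, hsv] using hsm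
        obtain ⟨a, b, rfl⟩ := List.append_of_mem hsm'
        rcases List.eq_nil_or_concat a with rfl | ⟨a, x, rfl⟩
        · exact absurd hs (HasPinnacles.head_notMem hS)
        have e : a.concat x ++ s :: b ++ [q, v] = a ++ x :: s :: (b ++ [q, v]) := by simp
        rw [e] at hS hr hmemS
        have hx : x ∉ S := by
          intro hx
          rw [hasPinnacles_append] at hS
          have h1 := (hS.2.1.1 hx).2
          have h2 := (hS.2.2.1.1 hs).1
          exact lt_asymm h1 h2
        have hxv : x ≤ v := hmax x (hmemS x (by simp)) hx
        have hr2 := balancedReach_block hS hx hq (hxv.trans_lt hvq) (fits_of_mem hs hvs)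
        have hr3 := hr.trans hr2
        have hS3 := hr3.hasPinnacles h
        rcases List.eq_nil_or_concat b.reverse with hb | ⟨b', y, hb⟩
        · rw [hb, hasPinnacles_append] at hS3
          have h1 := (hS3.2.2.1.1 hq).2
          have h2 := (hS3.2.2.2.1.1 hs).1
          exact absurd h1 (lt_asymm h2)
        · rw [hb] at hS3 hr3
          have e2 : a ++ x :: q :: (b'.concat y ++ [s, v]) = (a ++ x :: q :: b') ++ [y, s, v] := by
            simp
          rw [e2] at hS3 hr3
          refine ⟨_, y, _, hr3, by omega, ?_⟩
          intro hy
          rw [hasPinnacles_append] at hS3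
          have h1 := (hS3.2.1.1 hy).2
          have h2 := (hS3.2.2.1.1 hs).1
          exact lt_asymm h1 h2
    obtain ⟨m', y, j, hr', hj, hy⟩ := key
    have e : m' ++ [y, s, v] = m' ++ [y] ++ [s, v] := by simp
    have hnd' := hr'.perm.nodup_iff.1 hnd
    have hlen' := hr'.perm.length_eq
    have hS' := hr'.hasPinnacles h
    have hmem' : ∀ x, x ∈ m' ++ [y] → x ∈ l :=
      fun x hx => hr'.perm.mem_iff.2 (by simp at hx ⊢; tauto)
    have hcount' : (m' ++ [y] ++ [s, v]).length ≤
        2 * (m' ++ [y] ++ [s, v]).countP (· ∈ S) + 1 := by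
      have hp := hr.perm.symm.trans hr'.perm
      rw [← e, ← hp.length_eq, ← hp.countP_eq]
      exact hcount
    rw [e] at hr' hnd' hlen' hS'
    rw [List.nodup_append] at hnd'
    rw [hasPinnacles_append] at hS'
    refine (ih _ (by simp at hlen' ⊢; omega) _ (by simp) hnd'.1
      (hS'.1.change_right (fits_top hy)) rfl).concat_pinnacle (by simp) hv hs hvs ?_ ?_
      hcount' hr' (by omega)
    · intro x hx hxS
      exact lt_of_le_of_ne (hmax x (hmem' x hx) hxS) (hnd'.2.2 x hx v (by simp))
    · intro x hx hxS
      exact lt_of_le_of_ne (hsmax x (hmem' x hx) hxS) (hnd'.2.2 x hx s (by simp))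

end ListReversals

/-! ### From words back to permutations. -/

theorem hasPinnacles_iff_forall_split {α : Type*} [LinearOrder α] {S : Finset α}
    {u w : WithTop α} {l : List α} : HasPinnacles S u l w ↔
      ∀ a x b, l = a ++ x :: b → (x ∈ S ↔ lastOr a u < x ∧ headOr b w < x) := by
  constructor
  · rintro h a x b rfl
    exact ((hasPinnacles_append _ _).1 h).2.1
  · intro h
    induction l generalizing u with
    | nil => trivial
    | cons y l ih =>
      refine ⟨h [] y l rfl, ih fun a x b e => ?_⟩
      exact h (y :: a) x b (by rw [e]; rfl)

theorem apply_of_ofFn_eq {α : Type*} {n : ℕ} {f : Fin n → α} {a b : List α} {x : α}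
    (h : List.ofFn f = a ++ x :: b) (i : Fin n) (hi : (i : ℕ) = a.length) : f i = x := by
  have h1 : (List.ofFn f)[(i : ℕ)]? = some (f i) := by simp
  rw [h, hi] at h1
  simpa using h1.symm

theorem mem_pinnacleSet_iff_of_split {n : ℕ} {σ : Equiv.Perm (Fin n)} {a b : List (Fin n)}
    {x : Fin n} (h : List.ofFn σ = a ++ x :: b) :
    x ∈ pinnacleSet σ ↔ lastOr a ⊤ < x ∧ headOr b ⊤ < x := by
  have hlen : n = a.length + (b.length + 1) := by simpa using congrArg List.length h
  have hx := apply_of_ofFn_eq h ⟨a.length, by omega⟩ rfl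
  constructor
  · intro hm
    obtain ⟨i, j, k, hij, hjk, hj, hi, hk⟩ := (Finset.mem_filter.1 hm).2
    have ej : j = ⟨a.length, by omega⟩ := σ.injective (hj.trans hx.symm)
    rcases List.eq_nil_or_concat a with rfl | ⟨a, y, rfl⟩
    · rw [ej] at hij
      simp at hij
    rcases b with _ | ⟨z, b⟩
    · have := k.2
      simp [ej] at hjk hlen
      omega
    rw [List.concat_eq_append] at *
    have ei : σ i = y := apply_of_ofFn_eq (a := a) (b := x :: z :: b) (by simpa using h) i
      (by rw [ej] at hij; simpa using hij)
    have ek : σ k = z := apply_of_ofFn_eq (a := a ++ [y, x]) (b := b) (by simpa using h) k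
      (by rw [ej] at hjk; simp at hjk ⊢; omega)
    rw [hj] at hi hk
    subst ei ek
    simp [hi, hk]
  · rintro ⟨h1, h2⟩
    rcases List.eq_nil_or_concat a with rfl | ⟨a, y, rfl⟩
    · simp at h1
    rcases b with _ | ⟨z, b⟩
    · simp at h2
    rw [List.concat_eq_append] at *
    simp at hlen
    have ex := apply_of_ofFn_eq h ⟨a.length + 1, by omega⟩ (by simp)
    have ei := apply_of_ofFn_eq (a := a) (b := x :: z :: b) (by simpa using h)
      ⟨a.length, by omega⟩ rfl
    have ek := apply_of_ofFn_eq (a := a ++ [y, x]) (b := b) (by simpa using h)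
      ⟨a.length + 2, by omega⟩ (by simp)
    refine Finset.mem_filter.2 ⟨Finset.mem_univ _, ⟨a.length, by omega⟩,
      ⟨a.length + 1, by omega⟩, ⟨a.length + 2, by omega⟩, by simp, by simp, ex, ?_, ?_⟩
    · rw [ei, ex]
      simpa using h1
    · rw [ek, ex]
      simpa using h2

theorem hasPinnacles_ofFn_iff {n : ℕ} {S : Finset (Fin n)} {σ : Equiv.Perm (Fin n)} :
    HasPinnacles S ⊤ (List.ofFn σ) ⊤ ↔ pinnacleSet σ = S := by
  rw [hasPinnacles_iff_forall_split]
  constructor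
  · intro h
    ext x
    have hx : x ∈ List.ofFn σ := by simpa [List.mem_ofFn] using σ.surjective x
    obtain ⟨a, b, e⟩ := List.append_of_mem hx
    rw [h a x b e, mem_pinnacleSet_iff_of_split e]
  · rintro rfl a x b e
    exact mem_pinnacleSet_iff_of_split e

theorem ofFn_applyReversal {n : ℕ} {π : Equiv.Perm (Fin n)} {a b c : List (Fin n)} (hb : b ≠ [])
    (h : List.ofFn π = a ++ b ++ c) : ∃ i j : Fin n, i ≤ j ∧
      List.ofFn (applyReversal π i j) = a ++ b.reverse ++ c := by
  have hlen : n = a.length + (b.length + c.length) := by simpa using congrArg List.length h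
  have hb0 := List.length_pos_iff.2 hb
  refine ⟨⟨a.length, by omega⟩, ⟨a.length + b.length - 1, by omega⟩, by simp; omega, ?_⟩
  have hget : ∀ t (ht : t < n), some (π ⟨t, ht⟩) = (a ++ b ++ c)[t]? := by
    intro t ht
    rw [← h]
    simp [ht]
  apply List.ext_getElem
  · simp; omega
  · intro t h1 h2
    have ht : t < n := by simpa using h1
    apply Option.some_injective
    rw [← List.getElem?_eq_getElem h2, List.getElem_ofFn]
    change some (π (blockFlip _ _ _)) = _
    unfold blockFlip
    split_ifs with hc
    · simp only [Fin.mk_le_mk] at hc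
      change some (π ⟨a.length + (a.length + b.length - 1) - t, _⟩) = _
      rw [hget, List.append_assoc, List.append_assoc,
        List.getElem?_append_right (l₁ := a) (l₂ := b ++ c) (by omega),
        List.getElem?_append_right (l₁ := a) (l₂ := b.reverse ++ c) (by omega),
        List.getElem?_append_left (l₁ := b) (by omega),
        List.getElem?_append_left (l₁ := b.reverse) (by rw [List.length_reverse]; omega),
        List.getElem?_reverse (by omega)]
      congr 1
      omega
    · simp only [Fin.mk_le_mk] at hc
      rw [hget]
      by_cases hta : t < a.length
      · rw [List.append_assoc, List.append_assoc, List.getElem?_append_left hta,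
          List.getElem?_append_left hta]
      · rw [List.getElem?_append_right (by simp; omega),
          List.getElem?_append_right (by simp; omega)]
        simp

theorem BalancedReach.exists_balancedTransforms {n : ℕ} {k : ℕ} {l m : List (Fin n)}
    {π σ : Equiv.Perm (Fin n)} (h : BalancedReach (pinnacleSet π) k l m)
    (hl : List.ofFn π = l) (hm : List.ofFn σ = m) :
    ∃ R, BalancedTransforms R π σ ∧ R.length = k := by
  -- The set must stay fixed while the permutation varies in the induction.
  generalize hS : pinnacleSet π = S at h
  induction h generalizing π with
  | refl l =>
    refine ⟨[], ?_, rfl⟩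
    exact Equiv.coe_fn_injective (List.ofFn_injective (hl.trans hm.symm))
  | step a b c m hb h hr ih =>
    obtain ⟨i, j, hij, e⟩ := ofFn_applyReversal hb hl
    rw [← e, hasPinnacles_ofFn_iff] at h
    obtain ⟨R, hR, hRk⟩ := ih e hm h
    exact ⟨(i, j) :: R, ⟨⟨hij, h.trans hS.symm⟩, hR⟩, by simp [hRk]⟩

/-- Has the same case distinction as `canonicalFun`, to which it is compared. -/
theorem interleave_getElem? {α : Type*} (V s : List α) (h : s.length < V.length) (i : ℕ) :
    (interleave V s)[i]? =
      if i < 2 * s.length then if i % 2 = 1 then s[i / 2]? else V[i / 2]?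
      else V[i - s.length]? := by
  induction s generalizing V i with
  | nil => simp [interleave_nil]
  | cons x s ih =>
    cases V with
    | nil => simp at h
    | cons v V =>
      rcases i with _ | _ | i
      · simp [interleave]
      · simp [interleave]; intro h; omega
      · have e : (i + 1 + 1) / 2 = i / 2 + 1 := by omega
        have e' : (i + 1 + 1) % 2 = i % 2 := by omega
        simp only [interleave, List.getElem?_cons_succ, ih V (by simpa using h), e, e',
          List.length_cons]
        by_cases hi : i < 2 * s.length
        · rw [if_pos hi, if_pos (show i + 1 + 1 < 2 * (s.length + 1) by omega)]
        · rw [if_neg hi, if_neg (by omega),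
            show i + 1 + 1 - (s.length + 1) = i - s.length + 1 by omega,
            List.getElem?_cons_succ]

theorem ofFn_canonicalPerm {n : ℕ} (S : Finset (Fin n)) (hS : 2 * S.card < n) :
    List.ofFn (canonicalPerm S hS) =
      interleave (List.ofFn (Sᶜ.orderEmbOfFin rfl)) (List.ofFn (S.orderEmbOfFin rfl)) := by
  have hc : Sᶜ.card = n - S.card := by rw [Finset.card_compl, Fintype.card_fin]
  apply List.ext_getElem?
  intro i
  rw [interleave_getElem? _ _ (by simp only [List.length_ofFn]; omega)]
  simp only [List.length_ofFn]
  by_cases hi : i < n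
  · rw [List.getElem?_eq_getElem (by simpa using hi), List.getElem_ofFn]
    change some (canonicalFun S hS ⟨i, hi⟩) = _
    unfold canonicalFun
    simp only []
    split_ifs with h1 h2
    · rw [List.getElem?_eq_getElem (by simp; omega), List.getElem_ofFn]
    · rw [List.getElem?_eq_getElem (by simp only [List.length_ofFn]; omega), List.getElem_ofFn]
    · rw [List.getElem?_eq_getElem (by simp only [List.length_ofFn]; omega), List.getElem_ofFn]
  · rw [List.getElem?_eq_none (by simpa using hi), if_neg (by omega),
      List.getElem?_eq_none (by simp only [List.length_ofFn]; omega)]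

theorem eq_ofFn_orderEmbOfFin {α : Type*} [LinearOrder α] {l : List α} (S : Finset α)
    (hl : l.Pairwise (· < ·)) (hmem : ∀ x, x ∈ l ↔ x ∈ S) :
    l = List.ofFn (S.orderEmbOfFin rfl) := by
  have hs : (List.ofFn (S.orderEmbOfFin rfl)).Pairwise (· < ·) := by
    rw [List.pairwise_ofFn]
    exact fun i j hij => (S.orderEmbOfFin rfl).strictMono hij
  refine List.Perm.eq_of_pairwise (le := (· < ·)) (fun a b _ _ h h' => absurd h' h.not_gt) hl hs ?_
  rw [List.perm_ext_iff_of_nodup (hl.imp fun h => h.ne) (hs.imp fun h => h.ne)]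
  intro x
  rw [hmem, List.mem_ofFn, ← Set.mem_range, Finset.range_orderEmbOfFin, Finset.mem_coe]

theorem theorem1 (n : ℕ) (hn : 1 ≤ n) (π : Equiv.Perm (Fin n)) (p : ℕ)
    (hp : (pinnacleSet π).card = p) :
    ∃ R : List (Fin n × Fin n),
      BalancedTransforms R π
        (canonicalPerm (pinnacleSet π) (two_mul_card_pinnacleSet_lt hn π)) ∧
      (1 ≤ p → R.length ≤ 2 * n - min p 3) ∧
      (p = 0 → R.length ≤ 2 * n - 1) := by
  have hne : List.ofFn π ≠ [] := by
    rw [← List.length_pos_iff, List.length_ofFn]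
    exact hn
  obtain ⟨V, s, k, hV, hs, hVS, hsS, hlen, hr, hk⟩ := canBeSorted (S := pinnacleSet π)
    (List.ofFn π) hne (List.nodup_ofFn.2 π.injective) (hasPinnacles_ofFn_iff.2 rfl)
  have hmem : ∀ x, x ∈ V ∨ x ∈ s := by
    intro x
    rw [← List.mem_append, ← (hr.perm.trans (interleave_perm V s)).mem_iff, List.mem_ofFn]
    exact π.surjective x
  have eV := eq_ofFn_orderEmbOfFin (pinnacleSet π)ᶜ hV fun x => by
    rw [Finset.mem_compl]
    exact ⟨hVS x, fun h => (hmem x).resolve_right fun h' => h (hsS x h')⟩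
  have es := eq_ofFn_orderEmbOfFin (pinnacleSet π) hs fun x =>
    ⟨hsS x, fun h => (hmem x).resolve_left fun h' => hVS x h' h⟩
  have hsp : s.length = p := by rw [es, List.length_ofFn, hp]
  rw [eV, es, ← ofFn_canonicalPerm _ (two_mul_card_pinnacleSet_lt hn π)] at hr
  obtain ⟨R, hR, rfl⟩ := hr.exists_balancedTransforms rfl rfl
  rw [List.length_ofFn, hsp] at hk
  -- Both bounds follow from `R.length + p + 2 ≤ 2 * n`.
  exact ⟨R, hR, by omega, by omega⟩
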